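/- A \emph{Family Tree} is a locally finite directed tree in which every vertex has at most one outgoing edge; the edge of $v$, if any, leads to its \emph{parent}, and the vertices whose parent is $v$ are its \emph{children}. The Family Tree is \emph{ordered} if the children of each vertex are totally ordered. Let $\mathcal T_*$ be the space of isomorphism classes $[T,o]$ of rooted (resp. rooted ordered) Family Trees, where isomorphisms preserve the root and the edge directions (resp. also the order), with the local topology: it is induced by the metric $2^{-d}$, where $d$ is the supremum of the $r\ge 0$ such that the balls of radius $r$ around the two roots are isomorphic. Let $F$ be the parent vertex-shift, which maps a vertex to its parent if it has one and to itself otherwise. Let $\pi$ be a probability distribution on $\{0,1,2,\dots\}$ with mean $m(\pi)=\sum_k k\pi(k)=1$, and let $\hat\pi(k)=k\pi(k)$ be its size-biased distribution. The \emph{ordered Eternal Galton--Watson Tree} $EGWT(\pi)$ is the random rooted ordered Family Tree $[\mathbf T,\mathbf o]$ in which every vertex has a parent, all vertices reproduce independently, the ancestors $F^n(\mathbf o)$, $n\ge 1$, have offspring distribution $\hat\pi$, all other vertices have offspring distribution $\pi$, and the order among the children of every vertex is uniform. The \emph{ordered Eternal Kesten Tree} $EKT(\pi)$ is the random rooted ordered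 Family Tree $[\mathbf S,\mathbf u]$ with a bi-infinite path (spine) $(\mathbf o_n)_{n\in\mathbb Z}$, $\mathbf o_0=\mathbf u$, such that $\mathbf o_{n}$ is the parent of $\mathbf o_{n-1}$ for all $n$, all vertices reproduce independently, the vertices of the spine have offspring distribution $\hat\pi$, all other vertices have offspring distribution $\pi$, and the order among the children of every vertex is uniform. The unordered versions of both trees are obtained by forgetting the order. \textbf{Proposition.} The $F$-probability of the ordered $EGWT(\pi)$ is the ordered $EKT(\pi)$: the laws on $\mathcal T_*$ of $[\mathbf T,F^n(\mathbf o)]$ converge weakly, as $n\to\infty$, to the law of $[\mathbf S,\mathbf u]$. The same holds for the unordered $EGWT(\pi)$ and the unordered $EKT(\pi)$. -/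

import Mathlib

open MeasureTheory Filter Topology
open scoped ENNReal

/-! ### Family Trees and ordered Family Trees -/

/-- A Family Tree: a locally finite directed tree in which every vertex has out-degree at most one.
`edge u v` is the directed edge from `u` to `v`, that is, `v` is the parent of `u`. -/
structure FamilyTree where
  V : Type
  edge : V → V → Prop
  asymm : ∀ u v, edge u v → ¬ edge v u
  parent_unique : ∀ u v w, edge u v → edge u w → v = w
  isTree : (SimpleGraph.fromRel edge).IsTree
  locallyFinite : ∀ v, ((SimpleGraph.fromRel edge).neighborSet v).Finite

/-- An ordered Family Tree: the children of every vertex carry a strict total order.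
`lt` is the union of these orders; it relates siblings only. -/
structure OrderedFamilyTree extends FamilyTree where
  lt : V → V → Prop
  lt_sibling : ∀ u v, lt u v → ∃ w, edge u w ∧ edge v w
  lt_order : ∀ w, IsStrictTotalOrder {u : V // edge u w} (fun u v => lt u.1 v.1)

namespace FamilyTree

/-- The underlying undirected graph. -/
def graph (T : FamilyTree) : SimpleGraph T.V := SimpleGraph.fromRel T.edge

/-- The vertices at graph distance at most `r` from `o`. -/
def Ball (T : FamilyTree) (o : T.V) (r : ℕ) : Type := {v : T.V // T.graph.dist o v ≤ r}

open Classical in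
/-- The parent vertex-shift `F`: a vertex is mapped to its parent if it has one,
and to itself otherwise. -/
noncomputable def parentShift (T : FamilyTree) (v : T.V) : T.V :=
  if h : ∃ p, T.edge v p then h.choose else v

theorem parentShift_eq (T : FamilyTree) {v p : T.V} (h : T.edge v p) : T.parentShift v = p := by
  have h' : ∃ p, T.edge v p := ⟨p, h⟩
  rw [parentShift, dif_pos h']
  exact T.parent_unique _ _ _ h'.choose_spec h

theorem parentShift_eq_self (T : FamilyTree) {v : T.V} (h : ¬ ∃ p, T.edge v p) :
    T.parentShift v = v := dif_neg h

theorem parentShift_map {S T : FamilyTree} (φ : S.V ≃ T.V)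
    (hφ : ∀ u v, S.edge u v ↔ T.edge (φ u) (φ v)) (v : S.V) :
    φ (S.parentShift v) = T.parentShift (φ v) := by
  by_cases h : ∃ p, S.edge v p
  · obtain ⟨p, hp⟩ := h
    rw [S.parentShift_eq hp, T.parentShift_eq ((hφ v p).1 hp)]
  · have h' : ¬ ∃ p, T.edge (φ v) p := by
      rintro ⟨p, hp⟩
      exact h ⟨φ.symm p, (hφ _ _).2 (by simpa using hp)⟩
    rw [S.parentShift_eq_self h, T.parentShift_eq_self h']

end FamilyTree

/-- A rooted Family Tree `(T, o)`. -/
structure RootedFamilyTree where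
  tree : FamilyTree
  root : tree.V

/-- A rooted ordered Family Tree `(T, o)`. -/
structure RootedOrderedFamilyTree where
  tree : OrderedFamilyTree
  root : tree.V

namespace RootedFamilyTree

/-- Rooted isomorphism. -/
def Iso (S T : RootedFamilyTree) : Prop :=
  ∃ φ : S.tree.V ≃ T.tree.V, φ S.root = T.root ∧
    ∀ u v, S.tree.edge u v ↔ T.tree.edge (φ u) (φ v)

/-- Rooted isomorphism of the balls `S_r` and `T_r` of radius `r` around the roots. -/
def BallIso (r : ℕ) (S T : RootedFamilyTree) : Prop :=
  ∃ φ : S.tree.Ball S.root r ≃ T.tree.Ball T.root r,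
    (∀ u, u.1 = S.root ↔ (φ u).1 = T.root) ∧
    ∀ u v, S.tree.edge u.1 v.1 ↔ T.tree.edge (φ u).1 (φ v).1

instance setoid : Setoid RootedFamilyTree where
  r := Iso
  iseqv :=
    { refl := fun _ => ⟨Equiv.refl _, rfl, fun _ _ => Iff.rfl⟩
      symm := by
        rintro S T ⟨φ, h1, h2⟩
        exact ⟨φ.symm, by rw [← h1, φ.symm_apply_apply], fun u v => by rw [h2]; simp⟩
      trans := by
        rintro S T U ⟨φ, h1, h2⟩ ⟨ψ, k1, k2⟩
        exact ⟨φ.trans ψ, by simp [h1, k1], fun u v => by rw [h2, k2]; rfl⟩ }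

/-- `(T, o) ↦ (T, F(o))`. -/
noncomputable def parentShift (T : RootedFamilyTree) : RootedFamilyTree :=
  ⟨T.tree, T.tree.parentShift T.root⟩

end RootedFamilyTree

namespace RootedOrderedFamilyTree

/-- Forget the order. -/
def forget (T : RootedOrderedFamilyTree) : RootedFamilyTree := ⟨T.tree.toFamilyTree, T.root⟩

/-- Order preserving rooted isomorphism. -/
def Iso (S T : RootedOrderedFamilyTree) : Prop :=
  ∃ φ : S.tree.V ≃ T.tree.V, φ S.root = T.root ∧
    (∀ u v, S.tree.edge u v ↔ T.tree.edge (φ u) (φ v)) ∧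
    ∀ u v, S.tree.lt u v ↔ T.tree.lt (φ u) (φ v)

/-- Order preserving rooted isomorphism of the balls `S_r` and `T_r` of radius `r` around the
roots. -/
def BallIso (r : ℕ) (S T : RootedOrderedFamilyTree) : Prop :=
  ∃ φ : S.tree.Ball S.root r ≃ T.tree.Ball T.root r,
    (∀ u, u.1 = S.root ↔ (φ u).1 = T.root) ∧
    (∀ u v, S.tree.edge u.1 v.1 ↔ T.tree.edge (φ u).1 (φ v).1) ∧
    ∀ u v, S.tree.lt u.1 v.1 ↔ T.tree.lt (φ u).1 (φ v).1

instance setoid : Setoid RootedOrderedFamilyTree where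
  r := Iso
  iseqv :=
    { refl := fun _ => ⟨Equiv.refl _, rfl, fun _ _ => Iff.rfl, fun _ _ => Iff.rfl⟩
      symm := by
        rintro S T ⟨φ, h1, h2, h3⟩
        exact ⟨φ.symm, by rw [← h1, φ.symm_apply_apply], fun u v => by rw [h2]; simp,
          fun u v => by rw [h3]; simp⟩
      trans := by
        rintro S T U ⟨φ, h1, h2, h3⟩ ⟨ψ, k1, k2, k3⟩
        exact ⟨φ.trans ψ, by simp [h1, k1], fun u v => by rw [h2, k2]; rfl,
          fun u v => by rw [h3, k3]; rfl⟩ }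

/-- `(T, o) ↦ (T, F(o))`. -/
noncomputable def parentShift (T : RootedOrderedFamilyTree) : RootedOrderedFamilyTree :=
  ⟨T.tree, T.tree.parentShift T.root⟩

end RootedOrderedFamilyTree

/-! ### The spaces of isomorphism classes, with the local topology -/

/-- The space of isomorphism classes `[T, o]` of rooted (unordered) Family Trees. -/
def FamilyTreeSpace : Type 1 := Quotient RootedFamilyTree.setoid

/-- The space of isomorphism classes `[T, o]` of rooted ordered Family Trees. -/
def OrderedFamilyTreeSpace : Type 1 := Quotient RootedOrderedFamilyTree.setoid

namespace FamilyTreeSpace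

/-- The local topology, that is, the topology of the metric `2 ^ (-d)` where `d` is the supremum of
the radii at which the balls around the roots are isomorphic: it is generated by the sets of classes
whose `r`-ball is isomorphic to a given one. -/
instance : TopologicalSpace FamilyTreeSpace :=
  TopologicalSpace.generateFrom
    {U | ∃ (r : ℕ) (S : RootedFamilyTree),
      U = (fun T => (⟦T⟧ : FamilyTreeSpace)) '' {T | RootedFamilyTree.BallIso r S T}}

instance : MeasurableSpace FamilyTreeSpace := borel _

instance : BorelSpace FamilyTreeSpace := ⟨rfl⟩

/-- The map `θ_F`, `[T, o] ↦ [T, F(o)]`, induced by the parent vertex-shift. -/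
noncomputable def parentShift : FamilyTreeSpace → FamilyTreeSpace :=
  Quotient.map RootedFamilyTree.parentShift (by
    rintro S T ⟨φ, h1, h2⟩
    exact ⟨φ, by
      change φ (S.tree.parentShift S.root) = T.tree.parentShift T.root
      rw [FamilyTree.parentShift_map φ h2, h1], h2⟩)

end FamilyTreeSpace

namespace OrderedFamilyTreeSpace

/-- The local topology for ordered trees: isomorphisms of balls have to preserve the order. -/
instance : TopologicalSpace OrderedFamilyTreeSpace :=
  TopologicalSpace.generateFrom
    {U | ∃ (r : ℕ) (S : RootedOrderedFamilyTree),
      U = (fun T => (⟦T⟧ : OrderedFamilyTreeSpace)) '' {T | RootedOrderedFamilyTree.BallIso r S T}}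

instance : MeasurableSpace OrderedFamilyTreeSpace := borel _

instance : BorelSpace OrderedFamilyTreeSpace := ⟨rfl⟩

/-- The map `θ_F`, `[T, o] ↦ [T, F(o)]`, induced by the parent vertex-shift. -/
noncomputable def parentShift : OrderedFamilyTreeSpace → OrderedFamilyTreeSpace :=
  Quotient.map RootedOrderedFamilyTree.parentShift (by
    rintro S T ⟨φ, h1, h2, h3⟩
    exact ⟨φ, by
      change φ (S.tree.parentShift S.root) = T.tree.parentShift T.root
      rw [FamilyTree.parentShift_map φ h2, h1], h2, h3⟩)

/-- Forget the order. -/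
def forget : OrderedFamilyTreeSpace → FamilyTreeSpace :=
  Quotient.map RootedOrderedFamilyTree.forget (by
    rintro S T ⟨φ, h1, h2, _⟩
    exact ⟨φ, h1, h2⟩)

end OrderedFamilyTreeSpace

/-! ### Trees with a spine, built from the reproduction of their vertices

The spine is the path `o_i`, `b ≤ i`, where `o_{i+1}` is the parent of `o_i` and `b` is an integer
(the spine starts at `o_b`) or `⊥` (the spine is bi-infinite). The vertex `(i, w)` is reached
from `o_i = (i, [])` by following the word `w`, read from right to left, of labels of children. -/

/-- The reproduction of a vertex: the number `k` of its children, which get the labels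
`0, …, k - 1`, and a permutation of the labels, which defines the order among the children. -/
def Litter : Type := Σ k : ℕ, Equiv.Perm (Fin k)

instance : MeasurableSpace Litter := ⊤

/-- The place of the child with label `a` in the order among the children. -/
def Litter.place (l : Litter) (a : ℕ) : ℕ := if h : a < l.1 then (l.2 ⟨a, h⟩ : ℕ) else a

theorem Litter.place_injective (l : Litter) : Function.Injective l.place := by
  intro a c h
  unfold Litter.place at h
  split_ifs at h with h1 h2 h2
  · simpa using l.2.injective (Fin.ext h)
  · exact absurd (h ▸ (l.2 ⟨a, h1⟩).2) h2
  · exact absurd (h ▸ (l.2 ⟨c, h2⟩).2) h1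
  · exact h

namespace Spine

/-- The potential vertices. -/
abbrev Label : Type := ℤ × List ℕ

/-- The parent of a potential vertex. -/
def up : Label → Label
  | (i, []) => (i + 1, [])
  | (i, _ :: w) => (i, w)

/-- The label that a vertex has among its siblings; the spine child has label `0`. -/
def birth : Label → ℕ
  | (_, []) => 0
  | (_, a :: _) => a

/-- The generation of a potential vertex, increasing towards the ancestors. -/
def level (v : Label) : ℤ := v.1 - v.2.length

/-- The spine vertex `o_i` has a child on the spine, namely `o_{i-1}`. -/
def IsSpecial (b : WithBot ℤ) (v : Label) : Prop := v.2 = [] ∧ b < (v.1 : WithBot ℤ)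

/-- The words `w` that lead from the spine vertex `o_i` to a vertex, when the vertices reproduce
according to `ω`: each letter has to be the label of a child, and the label `0` of a special vertex
is taken by its spine child. -/
def ValidWord (b : WithBot ℤ) (ω : Label → Litter) (i : ℤ) : List ℕ → Prop
  | [] => True
  | a :: w => ValidWord b ω i w ∧ a < (ω (i, w)).1 ∧ (IsSpecial b (i, w) → a ≠ 0)

/-- The vertices that are really there: the spine, and with each vertex all its children. -/
def Valid (b : WithBot ℤ) (ω : Label → Litter) (v : Label) : Prop :=
  b ≤ (v.1 : WithBot ℤ) ∧ ValidWord b ω v.1 v.2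

theorem level_up (v : Label) : level (up v) = level v + 1 := by
  obtain ⟨i, _ | ⟨a, w⟩⟩ := v 
  · simp [level, up]
  · simp only [level, up, List.length_cons]
    push_cast
    ring

theorem valid_up {b : WithBot ℤ} {ω : Label → Litter} {v : Label} (h : Valid b ω v) :
    Valid b ω (up v) := by
  obtain ⟨i, _ | ⟨a, w⟩⟩ := v
  · exact ⟨h.1.trans (WithBot.coe_le_coe.2 (by simp [up])), trivial⟩
  · exact ⟨h.1, h.2.1⟩

theorem eq_of_up_eq {b : WithBot ℤ} {ω : Label → Litter} {u v : Label} (hu : Valid b ω u)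
    (hv : Valid b ω v) (h : up u = up v) (h' : birth u = birth v) : u = v := by
  have key : ∀ (i j : ℤ) (a : ℕ) (w : List ℕ), Valid b ω (i, []) → Valid b ω (j, a :: w) →
      up (i, []) = up (j, a :: w) → birth (i, []) ≠ birth (j, a :: w) := by
    intro i j a w hi hj e
    simp only [up, Prod.mk.injEq] at e
    obtain ⟨rfl, rfl⟩ := e
    refine (hj.2.2.2 ⟨rfl, lt_of_le_of_lt (show b ≤ (i : WithBot ℤ) from hi.1) ?_⟩).symm
    exact WithBot.coe_lt_coe.2 (by simp)
  obtain ⟨i, _ | ⟨a, w⟩⟩ := u <;> obtain ⟨j, _ | ⟨c, x⟩⟩ := v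
  · simpa [up] using h
  · exact absurd h' (key _ _ _ _ hu hv h)
  · exact absurd h'.symm (key _ _ _ _ hv hu h.symm)
  · simp_all [up, birth]

/-- The vertices. -/
abbrev Vertex (b : WithBot ℤ) (ω : Label → Litter) : Type := {v : Label // Valid b ω v}

/-- `v` is the parent of `u`. -/
def edge (b : WithBot ℤ) (ω : Label → Litter) (u v : Vertex b ω) : Prop := up u.1 = v.1

theorem adj_iff {b : WithBot ℤ} {ω : Label → Litter} {u v : Vertex b ω} :
    (SimpleGraph.fromRel (edge b ω)).Adj u v ↔ edge b ω u v ∨ edge b ω v u := by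
  rw [SimpleGraph.fromRel_adj]
  refine ⟨fun h => h.2, fun h => ⟨?_, h⟩⟩
  rintro rfl
  have := level_up u.1
  rcases h with h | h <;> · rw [show up u.1 = u.1 from h] at this; omega

theorem reachable_spine {b : WithBot ℤ} {ω : Label → Litter} (i : ℤ) (w : List ℕ)
    (h : Valid b ω (i, w)) : ∃ h' : Valid b ω (i, []),
      (SimpleGraph.fromRel (edge b ω)).Reachable ⟨(i, w), h⟩ ⟨(i, []), h'⟩ := by
  induction w with
  | nil => exact ⟨h, SimpleGraph.Reachable.refl _⟩
  | cons a w ih =>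
    obtain ⟨h', hr⟩ := ih ⟨h.1, h.2.1⟩
    have e : edge b ω ⟨(i, a :: w), h⟩ ⟨(i, w), ⟨h.1, h.2.1⟩⟩ := rfl
    exact ⟨h', (SimpleGraph.Adj.reachable (adj_iff.2 (Or.inl e))).trans hr⟩

theorem reachable_add {b : WithBot ℤ} {ω : Label → Litter} (i : ℤ) (n : ℕ)
    (h : Valid b ω (i, [])) : ∃ h' : Valid b ω (i + n, []),
      (SimpleGraph.fromRel (edge b ω)).Reachable ⟨(i, []), h⟩ ⟨(i + n, []), h'⟩ := by
  induction n with
  | zero => exact ⟨by simpa using h, by simp⟩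
  | succ n ih =>
    obtain ⟨h', hr⟩ := ih
    have e : up (i + (n : ℤ), []) = (i + ((n + 1 : ℕ) : ℤ), []) := by
      simp [up, add_assoc]
    exact ⟨e ▸ valid_up h', hr.trans (SimpleGraph.Adj.reachable (adj_iff.2 (Or.inl e)))⟩

theorem connected {b : WithBot ℤ} {ω : Label → Litter} (o : Vertex b ω) :
    (SimpleGraph.fromRel (edge b ω)).Connected := by
  have hle : ∀ (i j : ℤ) (hi : Valid b ω (i, [])) (hj : Valid b ω (j, [])), i ≤ j →
      (SimpleGraph.fromRel (edge b ω)).Reachable ⟨(i, []), hi⟩ ⟨(j, []), hj⟩ := by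
    intro i j hi hj hij
    obtain ⟨n, rfl⟩ : ∃ n : ℕ, j = i + n := ⟨(j - i).toNat, by omega⟩
    exact (reachable_add i n hi).2
  have : Nonempty (Vertex b ω) := ⟨o⟩
  refine ⟨?_⟩
  rintro ⟨⟨i, w⟩, hu⟩ ⟨⟨j, x⟩, hv⟩
  obtain ⟨hi, ri⟩ := reachable_spine i w hu
  obtain ⟨hj, rj⟩ := reachable_spine j x hv
  rcases le_total i j with hij | hij
  · exact ri.trans ((hle i j hi hj hij).trans rj.symm)
  · exact ri.trans ((hle j i hj hi hij).symm.trans rj.symm)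

theorem level_iterate (n : ℕ) (v : Label) : level (up^[n] v) = level v + n := by
  induction n with
  | zero => simp
  | succ n ih => rw [Function.iterate_succ_apply', level_up, ih]; push_cast; ring

theorem isAcyclic (b : WithBot ℤ) (ω : Label → Litter) :
    (SimpleGraph.fromRel (edge b ω)).IsAcyclic := by
  have key : ∀ u v : Vertex b ω, edge b ω u v →
      ¬ ((SimpleGraph.fromRel (edge b ω)).deleteEdges {s(u, v)}).Reachable u v := by
    intro u v huv ⟨p⟩
    have desc : ∀ (x y : Vertex b ω)
        (_ : ((SimpleGraph.fromRel (edge b ω)).deleteEdges {s(u, v)}).Walk x y),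
        (∃ n, up^[n] x.1 = u.1) → ∃ n, up^[n] y.1 = u.1 := by
      intro x y q
      induction q with
      | nil => exact id
      | cons hadj _ ih =>
        rename_i x y z _
        rintro ⟨n, hn⟩
        apply ih
        rw [SimpleGraph.deleteEdges_adj] at hadj
        rcases adj_iff.1 hadj.1 with hxy | hyx
        · cases n with
          | zero =>
            exfalso
            apply hadj.2
            have hxu : x = u := Subtype.ext hn
            subst hxu
            have : y = v := Subtype.ext (hxy.symm.trans huv)
            subst this
            rfl
          | succ n =>
            refine ⟨n, ?_⟩
            rw [Function.iterate_succ_apply, show up x.1 = y.1 from hxy] at hn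
            exact hn
        · refine ⟨n + 1, ?_⟩
          rw [Function.iterate_succ_apply, show up y.1 = x.1 from hyx]
          exact hn
    obtain ⟨n, hn⟩ := desc u v p ⟨0, rfl⟩
    have h1 := level_iterate n v.1
    have h2 := level_up u.1
    rw [show up u.1 = v.1 from huv] at h2
    rw [hn] at h1
    omega
  rw [SimpleGraph.isAcyclic_iff_forall_adj_isBridge]
  intro u v huv
  rw [SimpleGraph.isBridge_iff]
  rcases adj_iff.1 huv with h | h
  · exact key u v h
  · intro hr
    rw [Sym2.eq_swap] at hr
    exact key v u h hr.symm

theorem finite_neighborSet (b : WithBot ℤ) (ω : Label → Litter) (v : Vertex b ω) :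
    ((SimpleGraph.fromRel (edge b ω)).neighborSet v).Finite := by
  have hfin : (({up v.1, (v.1.1 - 1, [])} : Set Label) ∪
      (fun a => (v.1.1, a :: v.1.2)) '' Set.Iio (ω v.1).1).Finite :=
    (Set.toFinite _).union ((Set.finite_Iio _).image _)
  refine Set.Finite.subset (hfin.preimage Subtype.val_injective.injOn) ?_
  intro u hu
  rcases adj_iff.1 hu with h | h
  · exact Or.inl (Or.inl (show u.1 = up v.1 from h.symm))
  · obtain ⟨⟨j, _ | ⟨a, w⟩⟩, hu'⟩ := u
    · left; right
      have h : ((j + 1, []) : Label) = v.1 := h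
      simp [← h]
    · right
      have h : ((j, w) : Label) = v.1 := h
      refine ⟨a, ?_, by simp [← h]⟩
      rw [← h]
      exact hu'.2.2.1

/-- The ordered Family Tree in which the vertex `v` reproduces according to `ω v`. -/
def tree (b : WithBot ℤ) (hb : b ≤ 0) (ω : Label → Litter) : OrderedFamilyTree where
  V := Vertex b ω
  edge := edge b ω
  asymm u v h h' := by
    have h1 := level_up u.1
    have h2 := level_up v.1
    rw [show up u.1 = v.1 from h] at h1
    rw [show up v.1 = u.1 from h'] at h2
    omega
  parent_unique u v w h h' := Subtype.ext (h.symm.trans h')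
  isTree := ⟨connected ⟨(0, []), hb, trivial⟩, isAcyclic b ω⟩
  locallyFinite := finite_neighborSet b ω
  lt u v := up u.1 = up v.1 ∧ (ω (up u.1)).place (birth u.1) < (ω (up v.1)).place (birth v.1)
  lt_sibling u v h := ⟨⟨up u.1, valid_up u.2⟩, rfl, h.1.symm⟩
  lt_order w :=
    { irrefl := fun u h => lt_irrefl _ h.2
      trans := fun u v x h h' => ⟨h.1.trans h'.1, h.2.trans h'.2⟩
      trichotomous := by
        rintro ⟨u, hu⟩ ⟨v, hv⟩ h1 h2
        have e : up u.1 = up v.1 := (show up u.1 = w.1 from hu).trans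
          (show up v.1 = w.1 from hv).symm
        have h1' : ¬ (ω (up u.1)).place (birth u.1) < (ω (up v.1)).place (birth v.1) :=
          fun h => h1 ⟨e, h⟩
        have h2' : ¬ (ω (up v.1)).place (birth v.1) < (ω (up u.1)).place (birth u.1) :=
          fun h => h2 ⟨e.symm, h⟩
        have h3 := le_antisymm (not_lt.1 h2') (not_lt.1 h1')
        rw [e] at h3
        exact Subtype.ext (Subtype.ext (eq_of_up_eq u.2 v.2 e (Litter.place_injective _ h3))) }

/-- The class of the tree rooted at the spine vertex `o_0`. -/
def rootedTree (b : WithBot ℤ) (hb : b ≤ 0) (ω : Label → Litter) : OrderedFamilyTreeSpace :=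
  (⟦⟨tree b hb ω, ⟨(0, []), hb, trivial⟩⟩⟧ : Quotient RootedOrderedFamilyTree.setoid)

end Spine

/-! ### Eternal Galton-Watson Trees and Eternal Kesten Trees -/

/-- The mean `m(π)`. -/
noncomputable def offspringMean (π : PMF ℕ) : ℝ≥0∞ := ∑' k : ℕ, (k : ℝ≥0∞) * π k

/-- The size-biased distribution `k ↦ k π(k)` of a distribution of mean one. -/
noncomputable def sizeBiased (π : PMF ℕ) (hπ : offspringMean π = 1) : PMF ℕ :=
  ⟨fun k => (k : ℝ≥0∞) * π k, hπ ▸ ENNReal.summable.hasSum⟩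

/-- A number of children with law `π` and a uniform order among the children. -/
noncomputable def litterLaw (π : PMF ℕ) : PMF Litter :=
  π.bind fun k => (PMF.uniformOfFintype (Equiv.Perm (Fin k))).map fun σ => (⟨k, σ⟩ : Litter)

open Classical in
/-- All vertices reproduce independently: special vertices according to the size-biased
distribution, all others according to `π`; the order among the children is uniform. -/
noncomputable def reproductionLaw (b : WithBot ℤ) (π : PMF ℕ) (hπ : offspringMean π = 1) :
    Measure (Spine.Label → Litter) :=
  Measure.infinitePi fun v =>
    (if Spine.IsSpecial b v then litterLaw (sizeBiased π hπ) else litterLaw π).toMeasure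

instance (b : WithBot ℤ) (π : PMF ℕ) (hπ : offspringMean π = 1) :
    IsProbabilityMeasure (reproductionLaw b π hπ) := by
  unfold reproductionLaw
  infer_instance

/-- The ordered Eternal Galton-Watson Tree `EGWT(π)`, as a random element of the space of rooted
ordered Family Trees defined on the probability space with measure `reproductionLaw 0 π hπ`: the
spine is `o_n = F^n(o)`, `n ≥ 0`, the ancestors `o_n`, `n ≥ 1`, reproduce according to the
size-biased distribution, and all other vertices according to `π`. -/
def orderedEGWT : (Spine.Label → Litter) → OrderedFamilyTreeSpace :=
  Spine.rootedTree 0 le_rfl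

/-- The ordered Eternal Kesten Tree `EKT(π)`, as a random element defined on the probability space
with measure `reproductionLaw ⊥ π hπ`: the spine `o_n`, `n ∈ ℤ`, is bi-infinite, its vertices
reproduce according to the size-biased distribution, and all other vertices according to `π`. -/
def orderedEKT : (Spine.Label → Litter) → OrderedFamilyTreeSpace :=
  Spine.rootedTree ⊥ bot_le

/-- The unordered Eternal Galton-Watson Tree. -/
def unorderedEGWT (ω : Spine.Label → Litter) : FamilyTreeSpace := (orderedEGWT ω).forget

/-- The unordered Eternal Kesten Tree. -/
def unorderedEKT (ω : Spine.Label → Litter) : FamilyTreeSpace := (orderedEKT ω).forget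

/-! Moving the root of the EGWT to its `n`-th ancestor only relabels the tree. Counted from the new
root, the spine starts at `o_{-n}` instead of `o_0`, and the vertices reproduce according to the
shifted family `ω ∘ shift n` (`iterate_parentShift_rootedTree`). The reproduction law is a product
measure, so the shifted family has the product law with special vertices `o_i`, `i > -n`
(`map_shift_reproductionLaw`). It remains to let the start of the spine tend to `-∞`.

For this all the laws are coupled: each potential vertex draws one litter of each kind, once for all
`n`, and uses the one prescribed by its status (`map_select_pairLaw`). The status of a fixed vertex
agrees with its status in the Kesten tree for all large `n`. A ball around the root depends on the
litters of finitely many vertices only (`ballIso_rooted`, `finite_valid_height_le`), so the coupled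
trees converge pointwise in the local topology (`tendsto_rootedTree`), hence in distribution.
Forgetting the order is continuous and commutes with `F`, which yields the unordered statement. -/

namespace RootedOrderedFamilyTree

/-! ### Isomorphisms of balls -/

theorem BallIso.trans {r : ℕ} {S T U : RootedOrderedFamilyTree} (h : BallIso r S T)
    (k : BallIso r T U) : BallIso r S U := by
  obtain ⟨φ, h1, h2, h3⟩ := h
  obtain ⟨ψ, k1, k2, k3⟩ := k
  exact ⟨φ.trans ψ, fun u => (h1 u).trans (k1 _), fun u v => (h2 u v).trans (k2 _ _),
    fun u v => (h3 u v).trans (k3 _ _)⟩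

theorem BallIso.refl (r : ℕ) (S : RootedOrderedFamilyTree) : BallIso r S S :=
  ⟨Equiv.refl _, fun _ => Iff.rfl, fun _ _ => Iff.rfl, fun _ _ => Iff.rfl⟩

theorem BallIso.forget {r : ℕ} {S T : RootedOrderedFamilyTree} (h : BallIso r S T) :
    RootedFamilyTree.BallIso r S.forget T.forget := by
  obtain ⟨φ, h1, h2, _⟩ := h
  exact ⟨φ, h1, h2⟩

end RootedOrderedFamilyTree

namespace FamilyTree

/-- The isomorphism of the underlying graphs induced by an isomorphism of Family Trees. -/
def graphIso {S T : FamilyTree} (φ : S.V ≃ T.V) (h : ∀ u v, S.edge u v ↔ T.edge (φ u) (φ v)) :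
    S.graph ≃g T.graph where
  toEquiv := φ
  map_rel_iff' := by
    intro u v
    simp [graph, SimpleGraph.fromRel_adj, h]

theorem dist_map {S T : FamilyTree} (φ : S.V ≃ T.V)
    (h : ∀ u v, S.edge u v ↔ T.edge (φ u) (φ v)) (u v : S.V) :
    T.graph.dist (φ u) (φ v) = S.graph.dist u v := by
  apply le_antisymm
  · obtain ⟨p, hp⟩ := SimpleGraph.Connected.exists_walk_length_eq_dist (G := S.graph) S.isTree.connected u v
    have := SimpleGraph.dist_le (p.map (graphIso φ h).toHom)
    rw [SimpleGraph.Walk.length_map, hp] at this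
    exact this
  · obtain ⟨p, hp⟩ := SimpleGraph.Connected.exists_walk_length_eq_dist (G := T.graph) T.isTree.connected (φ u) (φ v)
    have := SimpleGraph.dist_le (p.map (graphIso φ h).symm.toHom)
    rw [SimpleGraph.Walk.length_map, hp] at this
    have e : ∀ x, (graphIso φ h).symm.toHom (φ x) = x := φ.symm_apply_apply
    rwa [e, e] at this

/-- An isomorphism of Family Trees restricts to the balls around corresponding vertices. -/
def ballEquiv {S T : FamilyTree} (φ : S.V ≃ T.V) (h : ∀ u v, S.edge u v ↔ T.edge (φ u) (φ v))
    {o : S.V} {o' : T.V} (ho : φ o = o') (r : ℕ) : S.Ball o r ≃ T.Ball o' r :=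
  φ.subtypeEquiv fun v => by rw [← ho, dist_map φ h]

end FamilyTree

namespace RootedFamilyTree

theorem Iso.ballIso {S T : RootedFamilyTree} (h : Iso S T) (r : ℕ) : BallIso r S T := by
  obtain ⟨φ, h1, h2⟩ := h
  exact ⟨FamilyTree.ballEquiv φ h2 h1 r, fun u => φ.apply_eq_iff_eq.symm.trans (by rw [h1]; rfl),
    fun u v => h2 _ _⟩

theorem BallIso.trans {r : ℕ} {S T U : RootedFamilyTree} (h : BallIso r S T)
    (k : BallIso r T U) : BallIso r S U := by
  obtain ⟨φ, h1, h2⟩ := h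
  obtain ⟨ψ, k1, k2⟩ := k
  exact ⟨φ.trans ψ, fun u => (h1 u).trans (k1 _), fun u v => (h2 u v).trans (k2 _ _)⟩

end RootedFamilyTree

theorem RootedOrderedFamilyTree.Iso.ballIso {S T : RootedOrderedFamilyTree} (h : Iso S T) (r : ℕ) :
    BallIso r S T := by
  obtain ⟨φ, h1, h2, h3⟩ := h
  exact ⟨FamilyTree.ballEquiv φ h2 h1 r, fun u => φ.apply_eq_iff_eq.symm.trans (by rw [h1]; rfl),
    fun u v => h2 _ _, fun u v => h3 _ _⟩

/-! ### Convergence and continuity in the local topology -/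

namespace OrderedFamilyTreeSpace

theorem tendsto_mk {ι : Type*} {l : Filter ι} {f : ι → RootedOrderedFamilyTree}
    {T : RootedOrderedFamilyTree}
    (h : ∀ r, ∀ᶠ a in l, RootedOrderedFamilyTree.BallIso r T (f a)) :
    Tendsto (β := OrderedFamilyTreeSpace) (fun a => ⟦f a⟧) l (𝓝 ⟦T⟧) := by
  refine TopologicalSpace.tendsto_nhds_generateFrom_iff.2 ?_
  rintro _ ⟨r, S, rfl⟩ ⟨T', hT', e⟩
  filter_upwards [h r] with a ha
  -- The generating set is an image in the quotient, so it provides only some representative `T'` of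
  -- the class of `T`.
  exact ⟨f a, (hT'.trans (RootedOrderedFamilyTree.Iso.ballIso (Quotient.exact e) r)).trans ha, rfl⟩

/-- An ordered isomorphism of balls is in particular an unordered one, so with each class the
preimage of a generating set contains all ordered trees having the same ordered `r`-ball. -/
theorem continuous_forget : Continuous forget := by
  refine continuous_generateFrom_iff.2 ?_
  rintro _ ⟨r, S, rfl⟩
  refine isOpen_iff_forall_mem_open.2 fun x => ?_
  induction x using Quotient.inductionOn with | _ T =>
  rintro ⟨T', hT', e⟩
  refine ⟨_, ?_, TopologicalSpace.isOpen_generateFrom_of_mem ⟨r, T, rfl⟩,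
    ⟨T, RootedOrderedFamilyTree.BallIso.refl r T, rfl⟩⟩
  rintro _ ⟨U, hU, rfl⟩
  have e' : RootedFamilyTree.Iso T' T.forget := Quotient.exact e
  exact ⟨U.forget, (hT'.trans (e'.ballIso r)).trans hU.forget, rfl⟩

theorem forget_parentShift (x : OrderedFamilyTreeSpace) :
    x.parentShift.forget = x.forget.parentShift :=
  Quotient.inductionOn x fun _ => rfl

theorem forget_iterate_parentShift (n : ℕ) (x : OrderedFamilyTreeSpace) :
    (parentShift^[n] x).forget = FamilyTreeSpace.parentShift^[n] x.forget :=
  (show Function.Semiconj forget parentShift FamilyTreeSpace.parentShift from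
    forget_parentShift).iterate_right n x

end OrderedFamilyTreeSpace

namespace Spine

/-! ### The distance to the root -/

/-- The distance of a potential vertex to the spine vertex `o_0`. -/
def height (v : Label) : ℕ := v.1.natAbs + v.2.length

theorem height_up_le (v : Label) : height (up v) ≤ height v + 1 := by
  obtain ⟨i, _ | ⟨a, w⟩⟩ := v <;> simp only [height, up, List.length_nil, List.length_cons] <;> omega

theorem height_le_up (v : Label) : height v ≤ height (up v) + 1 := by
  obtain ⟨i, _ | ⟨a, w⟩⟩ := v <;> simp only [height, up, List.length_nil, List.length_cons] <;> omega

/-- The spine vertex `o_0` as a vertex of the tree. -/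
def origin {b : WithBot ℤ} (hb : b ≤ 0) (ω : Label → Litter) : Vertex b ω :=
  ⟨(0, []), hb, trivial⟩

variable {b b' : WithBot ℤ} {ω ω' : Label → Litter}

/-- Crossing an edge changes the height by at most one; this gives the lower bound for distances. -/
theorem height_le_of_walk {u v : Vertex b ω} (p : (SimpleGraph.fromRel (edge b ω)).Walk u v) :
    height v.1 ≤ height u.1 + p.length := by
  induction p with
  | nil => simp
  | cons h p ih =>
    rename_i u v w
    rw [SimpleGraph.Walk.length_cons]
    have h1 := height_up_le u.1
    have h2 := height_le_up v.1
    rcases adj_iff.1 h with h | h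
    · rw [show up u.1 = v.1 from h] at h1
      omega
    · rw [show up v.1 = u.1 from h] at h2
      omega

theorem exists_walk_spine (hb : b ≤ 0) (ω : Label → Litter) (i : ℤ) (h : Valid b ω (i, [])) :
    ∃ p : (SimpleGraph.fromRel (edge b ω)).Walk (origin hb ω) ⟨(i, []), h⟩,
      p.length = i.natAbs := by
  induction i using Int.induction_on with
  | zero => exact ⟨SimpleGraph.Walk.nil, rfl⟩
  | succ i ih =>
    have h' : Valid b ω ((i : ℤ), []) :=
      ⟨hb.trans (WithBot.coe_le_coe.2 (by omega)), trivial⟩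
    obtain ⟨p, hp⟩ := ih h'
    have e : edge b ω ⟨(i, []), h'⟩ ⟨(i + 1, []), h⟩ := rfl
    refine ⟨p.concat (adj_iff.2 (Or.inl e)), ?_⟩
    rw [SimpleGraph.Walk.length_concat, hp]
    omega
  | pred i ih =>
    -- Below the root, validity of the nearer spine vertex comes from that of the farther one, not
    -- from `b ≤ 0`.
    have h' : Valid b ω (-(i : ℤ), []) :=
      ⟨h.1.trans (WithBot.coe_le_coe.2 (by simp)), trivial⟩
    obtain ⟨p, hp⟩ := ih h'
    have e : edge b ω ⟨(-i - 1, []), h⟩ ⟨(-i, []), h'⟩ := by simp [edge, up]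
    refine ⟨p.concat (adj_iff.2 (Or.inr e)), ?_⟩
    rw [SimpleGraph.Walk.length_concat, hp]
    omega

theorem exists_walk (hb : b ≤ 0) (ω : Label → Litter) (i : ℤ) (w : List ℕ)
    (h : Valid b ω (i, w)) :
    ∃ p : (SimpleGraph.fromRel (edge b ω)).Walk (origin hb ω) ⟨(i, w), h⟩,
      p.length = i.natAbs + w.length := by
  induction w with
  | nil => exact exists_walk_spine hb ω i h
  | cons a w ih =>
    obtain ⟨p, hp⟩ := ih ⟨h.1, h.2.1⟩
    have e : edge b ω ⟨(i, a :: w), h⟩ ⟨(i, w), ⟨h.1, h.2.1⟩⟩ := rfl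
    refine ⟨p.concat (adj_iff.2 (Or.inr e)), ?_⟩
    rw [SimpleGraph.Walk.length_concat, hp, List.length_cons, add_assoc]

/-- The distance is read off the label and involves neither `b` nor `ω`, so a label present in two
trees lies at the same distance from both roots. -/
theorem dist_origin (hb : b ≤ 0) (v : Vertex b ω) :
    (SimpleGraph.fromRel (edge b ω)).dist (origin hb ω) v = height v.1 := by
  obtain ⟨p, hp⟩ := exists_walk hb ω v.1.1 v.1.2 v.2
  refine le_antisymm ((SimpleGraph.dist_le p).trans hp.le) ?_
  obtain ⟨q, hq⟩ := (connected v).exists_walk_length_eq_dist (origin hb ω) v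
  have := height_le_of_walk q
  rw [hq] at this
  simpa [height, origin] using this

/-! ### Dependence of the tree on the reproduction of its vertices -/

theorem finite_validWord (b : WithBot ℤ) (ω : Label → Litter) (i : ℤ) (n : ℕ) :
    {w : List ℕ | ValidWord b ω i w ∧ w.length ≤ n}.Finite := by
  induction n with
  | zero => exact (Set.finite_singleton []).subset fun w hw => by simpa using hw.2
  | succ n ih =>
    refine ((Set.finite_singleton []).union
      (ih.biUnion fun w _ => (Set.finite_Iio (ω (i, w)).1).image (· :: w))).subset ?_
    rintro (_ | ⟨a, w⟩) ⟨h1, h2⟩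
    · exact Or.inl rfl
    · exact Or.inr (Set.mem_biUnion (show w ∈ {w | _} from ⟨h1.1, by simpa using h2⟩)
        ⟨a, h1.2.1, rfl⟩)

theorem finite_valid_height_le (b : WithBot ℤ) (ω : Label → Litter) (r : ℕ) :
    {v : Label | Valid b ω v ∧ height v ≤ r}.Finite := by
  refine ((Set.finite_Icc (-(r : ℤ)) r).biUnion fun i _ =>
    (finite_validWord b ω i r).image (Prod.mk i)).subset ?_
  rintro ⟨i, w⟩ ⟨h1, h2⟩
  simp only [height] at h2
  exact Set.mem_biUnion (show i ∈ Set.Icc (-(r : ℤ)) r from ⟨by omega, by omega⟩)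
    ⟨w, ⟨h1.2, by omega⟩, rfl⟩

/-- Whether a child exists is decided by the litter of its parent and by whether the parent is
special. Agreement of `ω` and `ω'` is required only at vertices valid for `ω`: these are finitely
many at bounded height, whereas the potential ones are not. -/
theorem valid_congr {r : ℕ}
    (hb : ∀ i : ℤ, i.natAbs ≤ r → ((b ≤ i ↔ b' ≤ i) ∧ (b < i ↔ b' < i)))
    (hω : ∀ v, Valid b ω v → height v ≤ r → ω' v = ω v) {v : Label} (hv : height v ≤ r) :
    Valid b ω v ↔ Valid b' ω' v := by
  obtain ⟨i, w⟩ := v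
  have hi : i.natAbs ≤ r := by simp only [height] at hv; omega
  induction w with
  | nil => exact and_congr (hb i hi).1 Iff.rfl
  | cons a w ih =>
    have hw : height (i, w) ≤ r := by simp only [height, List.length_cons] at hv ⊢; omega
    have key : ∀ c ω, Valid c ω (i, a :: w) ↔
        Valid c ω (i, w) ∧ a < (ω (i, w)).1 ∧ (IsSpecial c (i, w) → a ≠ 0) :=
      fun c ω => (and_assoc (a := c ≤ _)).symm
    rw [key, key]
    -- The litter of the parent is exchanged first, while the parent is still known to be valid for
    -- `ω`; only then is the validity of the parent exchanged.
    refine Iff.trans (and_congr_right fun h => ?_) (and_congr_left fun _ => ih hw)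
    rw [hω _ h hw, IsSpecial, IsSpecial, (hb i hi).2]

/-- The tree in which the vertex `v` reproduces according to `ω v`, with its root `o_0`. -/
def rooted (b : WithBot ℤ) (hb : b ≤ 0) (ω : Label → Litter) : RootedOrderedFamilyTree :=
  ⟨tree b hb ω, origin hb ω⟩

/-- The isomorphism is the identity on labels. Radius `r + 1` is needed because the order relation
refers to the litter of the parent, which may lie one step outside the ball. -/
theorem ballIso_rooted (hb₀ : b ≤ 0) (hb₀' : b' ≤ 0) {r : ℕ}
    (hb : ∀ i : ℤ, i.natAbs ≤ r + 1 → ((b ≤ i ↔ b' ≤ i) ∧ (b < i ↔ b' < i)))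
    (hω : ∀ v, Valid b ω v → height v ≤ r + 1 → ω' v = ω v) :
    RootedOrderedFamilyTree.BallIso r (rooted b hb₀ ω) (rooted b' hb₀' ω') := by
  have d : ∀ v : Vertex b ω, (rooted b hb₀ ω).tree.graph.dist (rooted b hb₀ ω).root v =
    height v.1 := dist_origin hb₀
  have d' : ∀ v : Vertex b' ω', (rooted b' hb₀' ω').tree.graph.dist (rooted b' hb₀' ω').root v =
    height v.1 := dist_origin hb₀'
  have hv : ∀ v, height v ≤ r + 1 → (Valid b ω v ↔ Valid b' ω' v) := fun v => valid_congr hb hω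
  let φ : (rooted b hb₀ ω).tree.Ball (rooted b hb₀ ω).root r ≃
      (rooted b' hb₀' ω').tree.Ball (rooted b' hb₀' ω').root r :=
    { toFun := fun v =>
        have h : height v.1.1 ≤ r := (d v.1).symm.trans_le v.2
        ⟨⟨v.1.1, (hv _ (by omega)).1 v.1.2⟩, (d' _).trans_le h⟩
      invFun := fun v =>
        have h : height v.1.1 ≤ r := (d' v.1).symm.trans_le v.2
        ⟨⟨v.1.1, (hv _ (by omega)).2 v.1.2⟩, (d _).trans_le h⟩
      left_inv := fun _ => rfl
      right_inv := fun _ => rfl }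
  refine ⟨φ, fun u => ?_, fun u v => Iff.rfl, fun u v => ?_⟩
  · exact (Subtype.ext_iff (p := Valid b ω) (a1 := u.1) (a2 := origin hb₀ ω)).trans
      (Subtype.ext_iff (p := Valid b' ω') (a1 := (φ u).1) (a2 := origin hb₀' ω')).symm
  · have e : ∀ u : (rooted b hb₀ ω).tree.Ball (rooted b hb₀ ω).root r,
        ω' (up u.1.1) = ω (up u.1.1) := fun u => by
      have h : height u.1.1 ≤ r := (d u.1).symm.trans_le u.2
      exact hω _ (valid_up u.1.2) ((height_up_le _).trans (by omega))
    change (_ ∧ (ω (up u.1.1)).place _ < (ω (up v.1.1)).place _) ↔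
      (_ ∧ (ω' (up u.1.1)).place _ < (ω' (up v.1.1)).place _)
    rw [e, e]
    rfl

/-- The tree depends continuously on the reproduction of its vertices and on the start of its
spine. -/
theorem tendsto_rootedTree {ι : Type*} {l : Filter ι} {c : ι → WithBot ℤ} (hb₀ : b ≤ 0)
    (hc₀ : ∀ a, c a ≤ 0) {η : ι → Label → Litter}
    (hc : ∀ r : ℕ, ∀ᶠ a in l, ∀ i : ℤ, i.natAbs ≤ r →
      ((b ≤ i ↔ c a ≤ i) ∧ (b < i ↔ c a < i)))
    (hη : ∀ v, ∀ᶠ a in l, η a v = ω v) :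
    Tendsto (fun a => rootedTree (c a) (hc₀ a) (η a)) l (𝓝 (rootedTree b hb₀ ω)) := by
  refine OrderedFamilyTreeSpace.tendsto_mk (T := rooted b hb₀ ω)
    (f := fun a => rooted (c a) (hc₀ a) (η a)) fun r => ?_
  filter_upwards [hc (r + 1),
    (finite_valid_height_le b ω (r + 1)).eventually_all.2 fun v _ => hη v] with a h1 h2
  exact ballIso_rooted hb₀ (hc₀ a) h1 fun v h h' => h2 v ⟨h, h'⟩

end Spine

/-! ### Discrete topology on litters and measurability of the tree -/

instance : Countable Litter := inferInstanceAs (Countable (Σ k : ℕ, Equiv.Perm (Fin k)))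

instance : TopologicalSpace Litter := ⊥

instance : DiscreteTopology Litter := ⟨rfl⟩

instance : DiscreteMeasurableSpace Litter := ⟨fun _ => trivial⟩

namespace Spine

variable {b b' : WithBot ℤ}

/-- The map is continuous for the product of the discrete topologies: near `ω`, any given litter is
constant. -/
theorem measurable_rootedTree (b : WithBot ℤ) (hb : b ≤ 0) : Measurable (rootedTree b hb) := by
  refine Continuous.measurable (continuous_iff_continuousAt.2 fun ω => ?_)
  refine tendsto_rootedTree hb (fun _ => hb) (fun r => Eventually.of_forall fun _ _ _ =>
    ⟨Iff.rfl, Iff.rfl⟩) fun v => ?_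
  exact (continuous_apply v).continuousAt.eventually_mem (isOpen_discrete {ω v} |>.mem_nhds rfl)

/-! ### Moving the root along the spine -/

/-- The shift of the labels that moves the spine vertex `o_0` to `o_n`. -/
def shift (n : ℤ) : Label ≃ Label := (Equiv.addRight n).prodCongr (Equiv.refl _)

theorem shift_apply (n i : ℤ) (w : List ℕ) : shift n (i, w) = (i + n, w) := rfl

theorem up_shift (n : ℤ) (v : Label) : up (shift n v) = shift n (up v) := by
  obtain ⟨i, _ | ⟨a, w⟩⟩ := v
  · simp only [up, shift_apply, add_right_comm]
  · rfl

theorem birth_shift (n : ℤ) (v : Label) : birth (shift n v) = birth v := by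
  obtain ⟨i, _ | ⟨a, w⟩⟩ := v <;> rfl

/-- The hypothesis encodes `b' = b - n` by comparisons, avoiding subtraction in `WithBot ℤ`. -/
theorem valid_shift {n : ℤ} (h : ∀ i : ℤ, (b' ≤ i ↔ b ≤ ↑(i + n)) ∧ (b' < i ↔ b < ↑(i + n)))
    (ω : Label → Litter) (v : Label) : Valid b' (ω ∘ shift n) v ↔ Valid b ω (shift n v) := by
  obtain ⟨i, w⟩ := v
  refine and_congr (h i).1 ?_
  change _ ↔ ValidWord b ω (i + n) w
  induction w with
  | nil => exact Iff.rfl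
  | cons a w ih =>
    refine and_congr ih (and_congr Iff.rfl ?_)
    rw [IsSpecial, IsSpecial, (h i).2]

theorem parentShift_rootedTree (hb : b ≤ 0) (hb' : b' ≤ 0)
    (h : ∀ i : ℤ, (b' ≤ i ↔ b ≤ ↑(i + 1)) ∧ (b' < i ↔ b < ↑(i + 1))) (ω : Label → Litter) :
    (rootedTree b hb ω).parentShift = rootedTree b' hb' (ω ∘ shift 1) := by
  refine Quotient.sound (Setoid.symm ?_)
  let φ : Vertex b' (ω ∘ shift 1) ≃ Vertex b ω := (shift 1).subtypeEquiv (valid_shift h ω)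
  refine ⟨φ, ?_, fun u v => ?_, fun u v => ?_⟩
  · refine ((tree b hb ω).parentShift_eq ?_).symm
    rfl
  · change up u.1 = v.1 ↔ up (shift 1 u.1) = shift 1 v.1
    rw [up_shift, (shift 1).injective.eq_iff]
  · change (_ = _ ∧ _ < _) ↔ (up (shift 1 u.1) = up (shift 1 v.1) ∧
      (ω (up (shift 1 u.1))).place (birth (shift 1 u.1)) <
        (ω (up (shift 1 v.1))).place (birth (shift 1 v.1)))
    simp only [up_shift, birth_shift, (shift 1).injective.eq_iff]
    rfl

end Spine

namespace Spine

theorem coe_neg_natCast_le_zero (n : ℕ) : ((-(n : ℤ) : ℤ) : WithBot ℤ) ≤ 0 :=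
  WithBot.coe_le_coe.2 (by omega)

theorem iterate_parentShift_rootedTree (n : ℕ) (ω : Label → Litter) :
    OrderedFamilyTreeSpace.parentShift^[n] (rootedTree 0 le_rfl ω) =
      rootedTree ((-(n : ℤ) : ℤ) : WithBot ℤ) (coe_neg_natCast_le_zero n) (ω ∘ shift n) := by
  induction n with
  | zero =>
    have e : shift ((0 : ℕ) : ℤ) = Equiv.refl _ := Equiv.ext fun v => by
      obtain ⟨i, w⟩ := v
      simp [shift_apply]
    rw [e]
    rfl
  | succ n ih =>
    have e : ∀ v, shift ((n + 1 : ℕ) : ℤ) v = shift n (shift 1 v) := by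
      rintro ⟨i, w⟩
      simp only [shift_apply]
      congr 1
      omega
    rw [Function.iterate_succ_apply', ih,
      parentShift_rootedTree _ (coe_neg_natCast_le_zero (n + 1)) fun i => ?_]
    · congr 1
      exact funext fun v => congrArg ω (e v).symm
    · simp only [WithBot.coe_le_coe, WithBot.coe_lt_coe]
      omega

/-! ### The coupling of the reproduction laws -/

open Classical in
/-- Choose the first component at the special vertices and the second one at all others. -/
noncomputable def select (b : WithBot ℤ) (x : Label → Litter × Litter) (v : Label) : Litter :=
  if IsSpecial b v then (x v).1 else (x v).2

theorem measurable_select (b : WithBot ℤ) : Measurable (select b) := by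
  refine measurable_pi_lambda _ fun v => ?_
  unfold select
  split_ifs
  · exact measurable_fst.comp (measurable_pi_apply v)
  · exact measurable_snd.comp (measurable_pi_apply v)

end Spine

/-- Every potential vertex chooses independently a reproduction according to the size-biased
distribution and one according to `π`. -/
noncomputable def pairLaw (π : PMF ℕ) (hπ : offspringMean π = 1) :
    Measure (Spine.Label → Litter × Litter) :=
  Measure.infinitePi fun _ =>
    (litterLaw (sizeBiased π hπ)).toMeasure.prod (litterLaw π).toMeasure

instance (π : PMF ℕ) (hπ : offspringMean π = 1) : IsProbabilityMeasure (pairLaw π hπ) := by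
  unfold pairLaw
  infer_instance

/-- Selection acts on each coordinate separately and there projects a product law to one of its
marginals. The source law is the same for all `b`, which makes this a coupling. -/
theorem map_select_pairLaw (b : WithBot ℤ) (π : PMF ℕ) (hπ : offspringMean π = 1) :
    (pairLaw π hπ).map (Spine.select b) = reproductionLaw b π hπ := by
  classical
  have h := Measure.infinitePi_map_pi (ι := Spine.Label)
    (μ := fun _ => (litterLaw (sizeBiased π hπ)).toMeasure.prod (litterLaw π).toMeasure)
    (f := fun v => if Spine.IsSpecial b v then Prod.fst else Prod.snd) fun v => by
      split_ifs
      exacts [measurable_fst, measurable_snd]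
  have e : Spine.select b = fun (x : Spine.Label → Litter × Litter) v =>
      (if Spine.IsSpecial b v then Prod.fst else Prod.snd) (x v) := by
    funext x v
    unfold Spine.select
    split_ifs <;> rfl
  rw [e, pairLaw, h, reproductionLaw]
  congr 1
  funext v
  split_ifs
  · exact Measure.map_fst_prod.trans (by simp)
  · exact Measure.map_snd_prod.trans (by simp)

theorem measurable_comp_shift (n : ℤ) :
    Measurable fun ω : Spine.Label → Litter => ω ∘ Spine.shift n :=
  measurable_pi_lambda _ fun v => measurable_pi_apply (Spine.shift n v)

/-- Reindexing a product measure by a bijection permutes its factors, and a factor depends only on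
whether the vertex is special; hence only strict comparisons with the start of the spine enter. -/
theorem map_shift_reproductionLaw {b b' : WithBot ℤ} {n : ℤ}
    (h : ∀ i : ℤ, b' < i ↔ b < ↑(i + n)) (π : PMF ℕ) (hπ : offspringMean π = 1) :
    (reproductionLaw b π hπ).map (fun ω => ω ∘ Spine.shift n) = reproductionLaw b' π hπ := by
  classical
  have e := Measure.infinitePi_map_piCongrLeft (X := fun _ : Spine.Label => Litter)
    (μ := fun v => (if Spine.IsSpecial b' v then litterLaw (sizeBiased π hπ)
      else litterLaw π).toMeasure) (Spine.shift n).symm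
  have e1 : ∀ v, Spine.IsSpecial b' ((Spine.shift n).symm v) ↔ Spine.IsSpecial b v := by
    intro v
    obtain ⟨⟨i, w⟩, rfl⟩ := (Spine.shift n).surjective v
    rw [Equiv.symm_apply_apply]
    exact and_congr Iff.rfl (h i)
  simp only [e1] at e
  have e2 : ⇑(MeasurableEquiv.piCongrLeft (fun _ : Spine.Label => Litter) (Spine.shift n).symm) =
      fun ω => ω ∘ Spine.shift n := by
    funext ω v
    obtain ⟨u, rfl⟩ := (Spine.shift n).symm.surjective v
    rw [MeasurableEquiv.piCongrLeft_apply_apply]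
    simp
  rw [e2] at e
  unfold reproductionLaw
  convert e

/-! ### Convergence in distribution -/

theorem tendstoInDistribution_orderedEGWT (π : PMF ℕ) (hπ : offspringMean π = 1) :
    TendstoInDistribution
      (fun (n : ℕ) ω => OrderedFamilyTreeSpace.parentShift^[n] (orderedEGWT ω)) atTop orderedEKT
      (fun _ => reproductionLaw 0 π hπ) (reproductionLaw ⊥ π hπ) := by
  let Y : (n : ℕ) → (Spine.Label → Litter) → OrderedFamilyTreeSpace := fun n =>
    Spine.rootedTree ((-(n : ℤ) : ℤ) : WithBot ℤ) (Spine.coe_neg_natCast_le_zero n)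
  have hY : ∀ n, Measurable (Y n) := fun n => Spine.measurable_rootedTree _ _
  have hZ : Measurable orderedEKT := Spine.measurable_rootedTree _ _
  have hX : (fun (n : ℕ) ω => OrderedFamilyTreeSpace.parentShift^[n] (orderedEGWT ω)) =
      fun n => Y n ∘ fun ω => ω ∘ Spine.shift n :=
    funext fun n => funext fun ω => Spine.iterate_parentShift_rootedTree n ω
  -- On the common space of the coupling the trees converge at every point `x`.
  have key : TendstoInDistribution (fun n x => Y n (Spine.select ((-(n : ℤ) : ℤ) : WithBot ℤ) x))
      atTop (fun x => orderedEKT (Spine.select ⊥ x)) (fun _ => pairLaw π hπ) (pairLaw π hπ) := by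
    refine tendstoInDistribution_of_ae_tendsto
      (fun n => ((hY n).comp (Spine.measurable_select _)).aemeasurable)
      (hZ.comp (Spine.measurable_select _)).aemeasurable (Eventually.of_forall fun x => ?_)
    -- At levels `|i| < n` the start `-n` is indistinguishable from `⊥`, both for the presence of
    -- `o_i` and for its being special.
    have hlt : ∀ (n : ℕ) (i : ℤ), i.natAbs < n → ((-(n : ℤ) : ℤ) : WithBot ℤ) < i :=
      fun n i h => WithBot.coe_lt_coe.2 (by omega)
    refine Spine.tendsto_rootedTree _ _ (fun r => ?_) fun v => ?_
    · filter_upwards [eventually_gt_atTop r] with n hn i hi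
      have := hlt n i (by omega)
      exact ⟨iff_of_true bot_le this.le, iff_of_true (WithBot.bot_lt_coe i) this⟩
    · filter_upwards [eventually_gt_atTop v.1.natAbs] with n hn
      have : Spine.IsSpecial ((-(n : ℤ) : ℤ) : WithBot ℤ) v ↔ Spine.IsSpecial ⊥ v :=
        and_congr Iff.rfl (iff_of_true (hlt n v.1 hn) (WithBot.bot_lt_coe v.1))
      classical exact if_congr this rfl rfl
  have hm : ∀ n : ℕ, Measurable (Y n ∘ fun ω => ω ∘ Spine.shift n) := fun n =>
    (hY n).comp (measurable_comp_shift n)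
  rw [hX]
  refine ⟨fun n => (hm n).aemeasurable, hZ.aemeasurable, ?_⟩
  -- Convergence in distribution concerns the individual laws only, so the coupled trees may be
  -- exchanged for the re-rooted EGWT: selection and shift both turn their source into the
  -- reproduction law with start `-n`.
  have hmap : ∀ n : ℕ, (pairLaw π hπ).map (Y n ∘ Spine.select ((-(n : ℤ) : ℤ) : WithBot ℤ)) =
      (reproductionLaw 0 π hπ).map (Y n ∘ fun ω => ω ∘ Spine.shift n) := fun n => by
    rw [← Measure.map_map (hY n) (measurable_comp_shift n),
      ← Measure.map_map (hY n) (Spine.measurable_select _), map_select_pairLaw,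
      map_shift_reproductionLaw (b' := ((-(n : ℤ) : ℤ) : WithBot ℤ)) fun i => ?_]
    rw [← WithBot.coe_zero, WithBot.coe_lt_coe, WithBot.coe_lt_coe]
    omega
  have hlim : (pairLaw π hπ).map (orderedEKT ∘ Spine.select ⊥) =
      (reproductionLaw ⊥ π hπ).map orderedEKT := by
    rw [← Measure.map_map hZ (Spine.measurable_select _), map_select_pairLaw]
  exact Tendsto.congr (fun n => Subtype.ext (hmap n))
    (key.tendsto.trans (le_of_eq (congrArg 𝓝 (Subtype.ext hlim))))

theorem mainTheorem11 (π : PMF ℕ) (hπ : offspringMean π = 1) :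
    TendstoInDistribution
      (fun (n : ℕ) ω => OrderedFamilyTreeSpace.parentShift^[n] (orderedEGWT ω)) atTop orderedEKT
      (fun _ => reproductionLaw 0 π hπ) (reproductionLaw ⊥ π hπ) ∧
    TendstoInDistribution
      (fun (n : ℕ) ω => FamilyTreeSpace.parentShift^[n] (unorderedEGWT ω)) atTop unorderedEKT
      (fun _ => reproductionLaw 0 π hπ) (reproductionLaw ⊥ π hπ) := by
  have h := tendstoInDistribution_orderedEGWT π hπ
  refine ⟨h, ?_⟩
  have e : (fun (n : ℕ) ω => FamilyTreeSpace.parentShift^[n] (unorderedEGWT ω)) =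
      fun n => OrderedFamilyTreeSpace.forget ∘
        fun ω => OrderedFamilyTreeSpace.parentShift^[n] (orderedEGWT ω) :=
    funext fun n => funext fun ω =>
      (OrderedFamilyTreeSpace.forget_iterate_parentShift n (orderedEGWT ω)).symm
  rw [e]
  exact h.continuous_comp OrderedFamilyTreeSpace.continuous_forget
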